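/- Let $k$ be a field, let $Q=k[X_1,X_2,X_3]$ with the standard grading, and let $I\subseteq Q$ be a homogeneous perfect ideal of grade $3$ (that is, $\operatorname{grade} I=3=\operatorname{pd}_Q(Q/I)$) whose minimal graded free resolution has format $(1,m,m+1,2)$ with $4\le m\le 7$, i.e. it has the form $$Q \longleftarrow \bigoplus_{i=1}^{m} Q(-d_{1,i}) \longleftarrow \bigoplus_{i=1}^{m+1} Q(-d_{2,i}) \longleftarrow \bigoplus_{i=1}^{2} Q(-d_{3,i}) \longleftarrow 0,$$ where the degrees are numbered such that $d_{1,1}\le d_{1,2}\le\cdots\le d_{1,m}$ and $d_{3,1}\le d_{3,2}$. If the initial degree of $I$ (the least degree of a nonzero form in $I$, which equals $d_{1,1}$) is at least $2$, then $$d_{3,2} > d_{1,1}+d_{1,2}.$$ Consequently, if the format of $I$ is $(1,5,6,2)$, $(1,6,7,2)$ or $(1,7,8,2)$ (the formats corresponding to the Dynkin diagrams $\mathrm{E}_6$, $\mathrm{E}_7$, $\mathrm{E}_8$), then $I$ avoids the Huneke–Ulrich numerical obstruction to being licci, i.e. the inequality $d_{3,2}\le 2d_{1,1}$ fails. -/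

import Mathlib

attribute [local instance] MvPolynomial.gradedAlgebra

/-- The grade of an ideal `I` of a commutative (Noetherian) ring `R`: the supremum of the lengths
of `R`-regular sequences contained in `I`. A weakly regular sequence contained in a proper ideal
is regular, and the unit ideal has grade `∞`, as is customary. -/
noncomputable def idealGrade {R : Type*} [CommRing R] (I : Ideal R) : ℕ∞ :=
  ⨆ rs : {rs : List R // (∀ r ∈ rs, r ∈ I) ∧ RingTheory.Sequence.IsWeaklyRegular R rs},
    (rs.1.length : ℕ∞)

/-- `I` is a perfect ideal of grade `g`: the grade of `I` and the projective dimension of `R ⧸ I`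
are both equal to `g`. -/
def IsPerfectOfGrade {R : Type*} [CommRing R] (I : Ideal R) (g : ℕ) : Prop :=
  idealGrade I = (g : ℕ∞) ∧
    CategoryTheory.projectiveDimension (ModuleCat.of R (R ⧸ I)) = ((g : ℕ∞) : WithBot ℕ∞)

section Graded

variable {k : Type*} [Field k] {e : ℕ}

/-- The initial degree of a nonzero homogeneous ideal: the least degree of a nonzero form
contained in it. (The value is `0` for the zero ideal.) -/
noncomputable def initialDegree (I : Ideal (MvPolynomial (Fin e) k)) : ℕ :=
  sInf {t : ℕ | ∃ f ∈ I, f ≠ 0 ∧ f.IsHomogeneous t}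

/-- The component of degree `t` of the graded free module `⨁ i, Q(-d i)` over
`Q = k[X_1, …, X_e]`: its elements are the vectors whose `i`-th entry is a form of degree
`t - d i` (and is `0` if `t < d i`). -/
noncomputable def twistedPiece {b : ℕ} (d : Fin b → ℕ) (t : ℕ) :
    Submodule k (Fin b → MvPolynomial (Fin e) k) :=
  Submodule.pi Set.univ fun i =>
    if d i ≤ t then MvPolynomial.homogeneousSubmodule (Fin e) k (t - d i) else ⊥

/-- The maps `φ₁, φ₂, φ₃` form a minimal graded free resolution
`0 → ⨁ Q(-d₃ i) → ⨁ Q(-d₂ i) → ⨁ Q(-d₁ i) → Q` of `Q ⧸ I`, where `Q = k[X_1, …, X_e]`. -/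
structure IsMinimalGradedResolution (I : Ideal (MvPolynomial (Fin e) k)) {b₁ b₂ b₃ : ℕ}
    (d₁ : Fin b₁ → ℕ) (d₂ : Fin b₂ → ℕ) (d₃ : Fin b₃ → ℕ)
    (φ₁ : (Fin b₁ → MvPolynomial (Fin e) k) →ₗ[MvPolynomial (Fin e) k] MvPolynomial (Fin e) k)
    (φ₂ : (Fin b₂ → MvPolynomial (Fin e) k) →ₗ[MvPolynomial (Fin e) k]
      (Fin b₁ → MvPolynomial (Fin e) k))
    (φ₃ : (Fin b₃ → MvPolynomial (Fin e) k) →ₗ[MvPolynomial (Fin e) k]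
      (Fin b₂ → MvPolynomial (Fin e) k)) : Prop where
  /-- The differentials are homogeneous of degree `0`. -/
  graded₁ : ∀ t, ∀ x ∈ twistedPiece d₁ t, (φ₁ x).IsHomogeneous t
  graded₂ : ∀ t, ∀ x ∈ twistedPiece d₂ t, φ₂ x ∈ twistedPiece d₁ t
  graded₃ : ∀ t, ∀ x ∈ twistedPiece d₃ t, φ₃ x ∈ twistedPiece d₂ t
  /-- The augmented complex `0 → F₃ → F₂ → F₁ → Q → Q ⧸ I → 0` is exact. -/
  range_eq : LinearMap.range φ₁ = I
  exact₁ : Function.Exact φ₂ φ₁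
  exact₂ : Function.Exact φ₃ φ₂
  injective : Function.Injective φ₃
  /-- Minimality: the image of each differential is contained in `(X_1, …, X_e)` times its
  target. -/
  minimal₁ : ∀ x, MvPolynomial.constantCoeff (φ₁ x) = 0
  minimal₂ : ∀ x i, MvPolynomial.constantCoeff (φ₂ x i) = 0
  minimal₃ : ∀ x i, MvPolynomial.constantCoeff (φ₃ x i) = 0

end Graded

/-! Write `a ≤ b` for the two smallest generator degrees and `c` for the largest last shift. Grade 3
in three variables makes `Q ⧸ I` of finite length, so the alternating sum of any polynomial of
degree at most 2 over the shifts vanishes (Herzog–Kühl, `shiftSum_eq_zero`). Suppose `c = b + u`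
with `u ≤ a`, and test with `p(x) = (x - b)(x - c)`. Minimality and duality place every generator
degree other than the first in `[b, c)` and every last shift in `[b + 2, c]`, where `p ≤ 0`;
moreover `p ≥ -u²/4` everywhere. Hence `4a(2b + u - a) ≤ (m + 1)u² ≤ 8u²`, while `u ≤ a ≤ b` makes
the left side at least `8u²`. Equality throughout leaves only `m = 7` with shifts `u`, `3u/2`, `2u`,
which the linear equation excludes. The Huneke–Ulrich claim follows from `a + b ≥ 2a`. The one bound
that is not formal is that each second shift lies below some last shift. It rests on exactness of
the dual complex, i.e. `Ext²(Q ⧸ I, Q) = 0`, made explicit in `exists_extension_of_isRegularTriple`.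
-/

open MvPolynomial

/-! ### Regular sequences and finite length of the quotient -/

/-- Three consecutive elements of a regular sequence, with regularity spelled out in terms of
ideal membership. -/
structure IsRegularTriple {R : Type*} [CommRing R] (r s t : R) : Prop where
  first : ∀ x, r * x = 0 → x = 0
  second : ∀ x, s * x ∈ Ideal.span {r} → x ∈ Ideal.span {r}
  third : ∀ x, t * x ∈ Ideal.span {r, s} → x ∈ Ideal.span {r, s}

theorem mem_ideal_of_isSMulRegular_quotient {R : Type*} [CommRing R] {J : Ideal R} {r : R}
    (h : IsSMulRegular (R ⧸ (J • ⊤ : Submodule R R)) r) (x : R) (hx : r * x ∈ J) : x ∈ J := by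
  have hJ : (J • ⊤ : Submodule R R) = J := by simp
  rw [hJ] at h
  rw [← Ideal.Quotient.eq_zero_iff_mem] at hx ⊢
  exact h (by simpa [Algebra.smul_def] using hx)

theorem exists_isRegularTriple {R : Type*} [CommRing R] {I : Ideal R} (h : 3 ≤ idealGrade I) :
    ∃ r ∈ I, ∃ s ∈ I, ∃ t ∈ I, IsRegularTriple r s t := by
  have h2 : (2 : ℕ∞) < idealGrade I := lt_of_lt_of_le (by norm_num) h
  obtain ⟨⟨rs, hmem, hreg⟩, hlen⟩ := lt_iSup_iff.mp h2
  have hlen : 2 < rs.length := by exact_mod_cast hlen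
  match rs, hlen with
  | r :: s :: t :: l, _ =>
    refine ⟨r, hmem _ (by simp), s, hmem _ (by simp), t, hmem _ (by simp), ?_, ?_, ?_⟩
    · intro x hx
      have := mem_ideal_of_isSMulRegular_quotient (hreg.regular_mod_prev 0 (by simp)) x
      simpa using this (by simpa using hx)
    · intro x hx
      have := mem_ideal_of_isSMulRegular_quotient (hreg.regular_mod_prev 1 (by simp)) x
      simpa [Ideal.ofList] using this (by simpa [Ideal.ofList] using hx)
    · intro x hx
      have := mem_ideal_of_isSMulRegular_quotient (hreg.regular_mod_prev 2 (by simp)) x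
      have e : Ideal.ofList (List.take 2 (r :: s :: t :: l)) = Ideal.span {r, s} := by
        simp [Ideal.ofList, Set.insert_def]
      rw [e] at this
      exact this hx

theorem ringKrullDim_quotient_add_one_le {R : Type*} [CommRing R] {J K : Ideal R} (hJK : J ≤ K)
    {r : R} (hr : r ∈ K) (h : ∀ x, r * x ∈ J → x ∈ J) :
    ringKrullDim (R ⧸ K) + 1 ≤ ringKrullDim (R ⧸ J) := by
  refine ringKrullDim_succ_le_of_surjective (Ideal.Quotient.factor hJK)
    (Ideal.Quotient.factor_surjective hJK) (r := Ideal.Quotient.mk J r) ?_ ?_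
  · rw [mem_nonZeroDivisors_iff_right]
    intro x hx
    obtain ⟨x, rfl⟩ := Ideal.Quotient.mk_surjective x
    rw [← map_mul, Ideal.Quotient.eq_zero_iff_mem, mul_comm] at hx
    exact Ideal.Quotient.eq_zero_iff_mem.mpr (h x hx)
  · simpa [Ideal.Quotient.eq_zero_iff_mem] using hr

/-- Each regular element lowers the Krull dimension by at least one, starting from 3. -/
theorem isArtinianRing_quotient_of_isRegularTriple {k : Type*} [Field k]
    {I : Ideal (MvPolynomial (Fin 3) k)} {r s t : MvPolynomial (Fin 3) k}
    (hr : r ∈ I) (hs : s ∈ I) (ht : t ∈ I) (h : IsRegularTriple r s t) :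
    IsArtinianRing (MvPolynomial (Fin 3) k ⧸ I) := by
  rw [isArtinianRing_iff_krullDimLE_zero, Ring.krullDimLE_iff]
  have h0 : ringKrullDim (MvPolynomial (Fin 3) k ⧸ (⊥ : Ideal (MvPolynomial (Fin 3) k))) = 3 := by
    rw [ringKrullDim_eq_of_ringEquiv (RingEquiv.quotientBot (MvPolynomial (Fin 3) k))]
    simp
  have h1 := ringKrullDim_quotient_add_one_le (J := ⊥) (K := Ideal.span {r}) bot_le
    (Ideal.mem_span_singleton_self r) (fun x hx => by simpa using h.first x (by simpa using hx))
  have h2 := ringKrullDim_quotient_add_one_le (J := Ideal.span {r}) (K := Ideal.span {r, s})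
    (Ideal.span_mono (by simp)) (Ideal.subset_span (by simp)) h.second
  have h3 := ringKrullDim_quotient_add_one_le (J := Ideal.span {r, s}) (K := I)
    (Ideal.span_le.mpr (by rintro x (rfl | rfl) <;> assumption)) ht h.third
  rw [h0] at h1
  have h4 : ringKrullDim (MvPolynomial (Fin 3) k ⧸ I) + 1 + 1 + 1 ≤ 3 :=
    (add_le_add_left (add_le_add_left h3 1) 1).trans ((add_le_add_left h2 1).trans h1)
  generalize ringKrullDim (MvPolynomial (Fin 3) k ⧸ I) = d at h4
  -- The dimension is `⊥` when `I` is the unit ideal, so that value is treated too.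
  induction d with
  | bot => exact bot_le
  | coe d =>
    induction d with
    | top => exact absurd h4 (by decide)
    | coe n =>
      have : n + 1 + 1 + 1 ≤ 3 := by
        have h5 : (((n + 1 + 1 + 1 : ℕ) : ℕ∞) : WithBot ℕ∞) ≤ ((3 : ℕ) : ℕ∞) := h4
        exact_mod_cast WithBot.coe_le_coe.mp h5
      have : n = 0 := by omega
      subst this
      exact le_rfl

/-- The powers of the irrelevant ideal stabilize modulo `I`. A form of large degree `n` is then
congruent mod `I` to an element of order at least `n + 1`, and the degree `n` component of the
difference is the form itself. -/
theorem exists_forall_isHomogeneous_mem {σ k : Type*} [Field k]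
    {I : Ideal (MvPolynomial σ k)} (hI : I.IsHomogeneous (homogeneousSubmodule σ k))
    [IsArtinianRing (MvPolynomial σ k ⧸ I)] :
    ∃ N, ∀ n ≥ N, ∀ f : MvPolynomial σ k, f.IsHomogeneous n → f ∈ I := by
  let a : ℕ →o (Ideal (MvPolynomial σ k ⧸ I))ᵒᵈ :=
    { toFun := fun n => OrderDual.toDual ((idealOfVars σ k ^ n).map (Ideal.Quotient.mk I))
      monotone' := fun m n h => Ideal.map_mono (Ideal.pow_le_pow_right h) }
  obtain ⟨N, hN⟩ := IsArtinian.monotone_stabilizes a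
  refine ⟨N, fun n hn f hf => ?_⟩
  have e : (idealOfVars σ k ^ n).map (Ideal.Quotient.mk I) =
      (idealOfVars σ k ^ (n + 1)).map (Ideal.Quotient.mk I) :=
    (hN n hn).symm.trans (hN (n + 1) (by omega))
  have hfn : f ∈ idealOfVars σ k ^ n := by
    rw [mem_pow_idealOfVars_iff']
    intro x hx
    exact hf.coeff_eq_zero (by omega)
  have h1 : Ideal.Quotient.mk I f ∈ (idealOfVars σ k ^ (n + 1)).map (Ideal.Quotient.mk I) :=
    e ▸ Ideal.mem_map_of_mem _ hfn
  rw [Ideal.mem_map_iff_of_surjective _ Ideal.Quotient.mk_surjective] at h1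
  obtain ⟨g, hg, hgf⟩ := h1
  have h2 : f - g ∈ I := by rw [← Ideal.Quotient.eq, hgf]
  have h3 := homogeneousComponent_mem_of_mem hI h2 n
  have h4 : homogeneousComponent n g = 0 := by
    ext d
    rw [coeff_homogeneousComponent]
    split_ifs with hd
    · simpa using (mem_pow_idealOfVars_iff' _ _).mp hg d (by omega)
    · simp
  rwa [map_sub, h4, sub_zero, homogeneousComponent_eq_self hf] at h3

/-! ### Graded pieces of free modules and their dimensions -/

section TwistedPieces

variable {k : Type*} [Field k] {e : ℕ}

theorem mem_twistedPiece {b : ℕ} {d : Fin b → ℕ} {t : ℕ} {x : Fin b → MvPolynomial (Fin e) k} :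
    x ∈ twistedPiece d t ↔ ∀ i, (d i ≤ t → (x i).IsHomogeneous (t - d i)) ∧
      (t < d i → x i = 0) := by
  rw [twistedPiece, Submodule.mem_pi]
  refine ⟨fun h i => ?_, fun h i _ => ?_⟩
  · have := h i trivial
    split_ifs at this with hi
    · exact ⟨fun _ => this, fun h' => by omega⟩
    · exact ⟨fun h' => by omega, fun _ => by simpa using this⟩
  · split_ifs with hi
    · exact (h i).1 hi
    · simpa using (h i).2 (by omega)

/-- The projection of a graded free module onto its component of degree `t`. -/
noncomputable def twistedProj {b : ℕ} (d : Fin b → ℕ) (t : ℕ) :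
    (Fin b → MvPolynomial (Fin e) k) →ₗ[k] (Fin b → MvPolynomial (Fin e) k) :=
  LinearMap.pi fun i =>
    if d i ≤ t then (homogeneousComponent (t - d i)).comp (LinearMap.proj i) else 0

theorem twistedProj_apply {b : ℕ} (d : Fin b → ℕ) (t : ℕ) (x : Fin b → MvPolynomial (Fin e) k)
    (i : Fin b) :
    twistedProj d t x i = if d i ≤ t then homogeneousComponent (t - d i) (x i) else 0 := by
  rw [twistedProj, LinearMap.pi_apply]
  split_ifs <;> rfl

theorem twistedProj_mem {b : ℕ} (d : Fin b → ℕ) (t : ℕ) (x : Fin b → MvPolynomial (Fin e) k) :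
    twistedProj d t x ∈ twistedPiece d t := by
  rw [mem_twistedPiece]
  intro i
  rw [twistedProj_apply]
  refine ⟨fun h => ?_, fun h => if_neg (by omega)⟩
  rw [if_pos h]
  exact homogeneousComponent_isHomogeneous _ _

theorem twistedProj_of_mem {b : ℕ} {d : Fin b → ℕ} {s : ℕ} (t : ℕ)
    {x : Fin b → MvPolynomial (Fin e) k} (hx : x ∈ twistedPiece d s) :
    twistedProj d t x = if s = t then x else 0 := by
  rw [mem_twistedPiece] at hx
  ext1 i
  rw [twistedProj_apply]
  rcases le_or_gt (d i) s with h | h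
  · have hi := (hx i).1 h
    split_ifs with h1 h2 h2
    · subst h2; exact homogeneousComponent_eq_self hi
    · rw [homogeneousComponent_of_mem hi, if_neg (by omega)]; rfl
    · omega
    · rfl
  · have hi := (hx i).2 h
    split_ifs <;> simp [hi]

theorem exists_sum_twistedProj {b : ℕ} (d : Fin b → ℕ) (x : Fin b → MvPolynomial (Fin e) k) :
    ∃ N, ∑ s ∈ Finset.range N, twistedProj d s x = x := by
  refine ⟨∑ i, ((x i).totalDegree + d i + 1), ?_⟩
  ext1 i
  ext m
  rw [Finset.sum_apply, coeff_sum]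
  simp only [twistedProj_apply]
  by_cases hm : coeff m (x i) = 0
  · rw [hm]
    refine Finset.sum_eq_zero fun s _ => ?_
    split_ifs
    · rw [coeff_homogeneousComponent, hm, ite_self]
    · simp
  · rw [Finset.sum_eq_single (m.degree + d i)]
    · rw [if_pos (by omega), coeff_homogeneousComponent, if_pos (by omega)]
    · intro s _ hs
      split_ifs
      · rw [coeff_homogeneousComponent, if_neg (by omega)]
      · simp
    · intro h
      exfalso
      apply h
      rw [Finset.mem_range]
      have h1 : m.degree ≤ (x i).totalDegree := by
        have := le_totalDegree (mem_support_iff.mpr hm)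
        exact this
      have h2 := Finset.single_le_sum (f := fun i => (x i).totalDegree + d i + 1)
        (fun _ _ => Nat.zero_le _) (Finset.mem_univ i)
      omega

/-- A linear map between graded free modules that is homogeneous of degree `0`. -/
def IsGradedMap {a b : ℕ} (d : Fin a → ℕ) (d' : Fin b → ℕ)
    (φ : (Fin a → MvPolynomial (Fin e) k) →ₗ[MvPolynomial (Fin e) k]
      (Fin b → MvPolynomial (Fin e) k)) : Prop :=
  ∀ t, ∀ x ∈ twistedPiece d t, φ x ∈ twistedPiece d' t

variable {a b c : ℕ} {d : Fin a → ℕ} {d' : Fin b → ℕ} {d'' : Fin c → ℕ}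
  {φ : (Fin a → MvPolynomial (Fin e) k) →ₗ[MvPolynomial (Fin e) k]
    (Fin b → MvPolynomial (Fin e) k)}
  {ψ : (Fin b → MvPolynomial (Fin e) k) →ₗ[MvPolynomial (Fin e) k]
    (Fin c → MvPolynomial (Fin e) k)}

theorem IsGradedMap.map_twistedProj (h : IsGradedMap d d' φ) (t : ℕ)
    (x : Fin a → MvPolynomial (Fin e) k) :
    φ (twistedProj d t x) = twistedProj d' t (φ x) := by
  obtain ⟨N, hN⟩ := exists_sum_twistedProj d x
  have key : ∀ s, φ (twistedProj d t (twistedProj d s x)) =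
      twistedProj d' t (φ (twistedProj d s x)) := by
    intro s
    rw [twistedProj_of_mem t (twistedProj_mem d s x),
      twistedProj_of_mem t (h s _ (twistedProj_mem d s x))]
    split_ifs <;> simp
  conv_lhs => rw [← hN]
  conv_rhs => rw [← hN]
  simp only [map_sum, key]

/-- Exactness passes to each degree: any preimage of a homogeneous element may be replaced by its
component in that degree. -/
theorem IsGradedMap.map_twistedPiece_of_exact (h : IsGradedMap d d' φ)
    (hex : Function.Exact φ ψ) (t : ℕ) :
    (twistedPiece d t).map (φ.restrictScalars k) =
      twistedPiece d' t ⊓ LinearMap.ker (ψ.restrictScalars k) := by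
  ext x
  simp only [Submodule.mem_map, Submodule.mem_inf, LinearMap.mem_ker,
    LinearMap.coe_restrictScalars]
  constructor
  · rintro ⟨y, hy, rfl⟩
    exact ⟨h t y hy, hex.apply_apply_eq_zero y⟩
  · rintro ⟨hx, hx0⟩
    obtain ⟨y, rfl⟩ := (hex x).mp hx0
    refine ⟨twistedProj d t y, twistedProj_mem d t y, ?_⟩
    rw [h.map_twistedProj, twistedProj_of_mem t hx, if_pos rfl]

theorem finrank_map_add_finrank_inf_ker {K V W : Type*} [Field K] [AddCommGroup V] [Module K V]
    [AddCommGroup W] [Module K W] (f : V →ₗ[K] W) (P : Submodule K V) [FiniteDimensional K P] :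
    Module.finrank K (P.map f) + Module.finrank K (P ⊓ LinearMap.ker f : Submodule K V) =
      Module.finrank K P := by
  rw [← (f.domRestrict P).finrank_range_add_finrank_ker, LinearMap.range_domRestrict,
    LinearMap.ker_domRestrict]
  congr 1
  have := Submodule.finrank_map_subtype_eq P ((LinearMap.ker f).submoduleOf P)
  rw [Submodule.submoduleOf, Submodule.map_comap_subtype] at this
  exact this

/-- The component of degree `t` of a graded free module as a product of spaces of forms. -/
noncomputable def twistedPieceEquiv {b : ℕ} (d : Fin b → ℕ) (t : ℕ) (h : ∀ i, d i ≤ t) :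
    twistedPiece (k := k) (e := e) d t ≃ₗ[k]
      ((i : Fin b) → homogeneousSubmodule (Fin e) k (t - d i)) where
  toFun x i := ⟨x.1 i, (mem_twistedPiece.mp x.2 i).1 (h i)⟩
  invFun y := ⟨fun i => (y i).1, mem_twistedPiece.mpr fun i =>
    ⟨fun _ => (y i).2, fun h' => absurd (h i) (by omega)⟩⟩
  map_add' _ _ := rfl
  map_smul' _ _ := rfl
  left_inv _ := rfl
  right_inv _ := rfl

instance finite_homogeneousSubmodule (n : ℕ) :
    Module.Finite k (homogeneousSubmodule (Fin e) k n) :=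
  Module.Finite.iff_fg.mpr (homogeneousSubmodule_fg (Fin e) k n)

theorem finite_twistedPiece {b : ℕ} (d : Fin b → ℕ) (t : ℕ) (h : ∀ i, d i ≤ t) :
    Module.Finite k (twistedPiece (k := k) (e := e) d t) :=
  Module.Finite.equiv (twistedPieceEquiv d t h).symm

theorem finrank_homogeneousSubmodule (n : ℕ) :
    Module.finrank k (homogeneousSubmodule (Fin 3) k n) = (n + 2).choose 2 := by
  rw [homogeneousSubmodule_eq_finsupp_supported]
  have h := Module.finrank_eq_nat_card_basis
    (basisRestrictSupport k {d : Fin 3 →₀ ℕ | d.degree = n})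
  refine h.trans ?_
  have e : {d : Fin 3 →₀ ℕ | d.degree = n} =
      ((Finset.univ : Finset (Fin 3)).finsuppAntidiag n : Set (Fin 3 →₀ ℕ)) := by
    ext d
    simp [Finsupp.degree_eq_sum]
  rw [e, Nat.card_eq_card_toFinset]
  simp only [Finset.toFinset_coe, Finset.card_finsuppAntidiag_nat_eq_choose, Finset.card_univ,
    Fintype.card_fin]
  rw [show 3 + n - 1 = n + 2 by omega, Nat.choose_symm_add]

theorem finrank_twistedPiece {b : ℕ} (d : Fin b → ℕ) (t : ℕ) (h : ∀ i, d i ≤ t) :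
    (2 * Module.finrank k (twistedPiece (k := k) (e := 3) d t) : ℤ) =
      ∑ i, ((t : ℤ) - d i + 2) * (t - d i + 1) := by
  rw [(twistedPieceEquiv d t h).finrank_eq, Module.finrank_pi_fintype, Nat.cast_sum,
    Finset.mul_sum]
  refine Finset.sum_congr rfl fun i _ => ?_
  rw [finrank_homogeneousSubmodule]
  obtain ⟨n, hn⟩ := Nat.exists_eq_add_of_le (h i)
  rw [hn, Nat.add_sub_cancel_left]
  have h2 : (n + 2).choose 2 * 2 = (n + 2) * (n + 1) := by
    rw [Nat.choose_two_right]
    exact Nat.div_mul_cancel (by simpa using (Nat.even_mul_pred_self (n + 2)).two_dvd)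
  have h3 : (((n + 2).choose 2 : ℕ) : ℤ) * 2 = (n + 2) * (n + 1) := by exact_mod_cast h2
  push_cast
  linarith

end TwistedPieces

/-! ### The Herzog–Kühl equations -/

/-- The alternating sum of the values of `f` at the degree shifts of a free resolution. -/
def shiftSum {b₁ b₂ b₃ : ℕ} (d₁ : Fin b₁ → ℕ) (d₂ : Fin b₂ → ℕ) (d₃ : Fin b₃ → ℕ) :
    (ℤ → ℤ) →ₗ[ℤ] ℤ where
  toFun f := f 0 - ∑ i, f (d₁ i) + ∑ i, f (d₂ i) - ∑ i, f (d₃ i)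
  map_add' f g := by simp only [Pi.add_apply, Finset.sum_add_distrib]; ring
  map_smul' r f := by
    simp only [Pi.smul_apply, smul_eq_mul, ← Finset.mul_sum, RingHom.id_apply]; ring

section Resolution

variable {k : Type*} [Field k] {I : Ideal (MvPolynomial (Fin 3) k)} {b₁ b₂ b₃ : ℕ}
  {d₁ : Fin b₁ → ℕ} {d₂ : Fin b₂ → ℕ} {d₃ : Fin b₃ → ℕ}
  {φ₁ : (Fin b₁ → MvPolynomial (Fin 3) k) →ₗ[MvPolynomial (Fin 3) k] MvPolynomial (Fin 3) k}
  {φ₂ : (Fin b₂ → MvPolynomial (Fin 3) k) →ₗ[MvPolynomial (Fin 3) k]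
    (Fin b₁ → MvPolynomial (Fin 3) k)}
  {φ₃ : (Fin b₃ → MvPolynomial (Fin 3) k) →ₗ[MvPolynomial (Fin 3) k]
    (Fin b₂ → MvPolynomial (Fin 3) k)}

/-- The Euler characteristic of the strand of degree `t`, to which `Q ⧸ I` contributes nothing
because every form of degree `t` lies in `I`. -/
theorem IsMinimalGradedResolution.finrank_eq (h : IsMinimalGradedResolution I d₁ d₂ d₃ φ₁ φ₂ φ₃)
    {t : ℕ} (ht : ∀ f : MvPolynomial (Fin 3) k, f.IsHomogeneous t → f ∈ I)
    (h₁ : ∀ i, d₁ i ≤ t) (h₂ : ∀ i, d₂ i ≤ t) (h₃ : ∀ i, d₃ i ≤ t) :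
    Module.finrank k (twistedPiece (k := k) (e := 3) (fun _ : Fin 1 => 0) t) +
        Module.finrank k (twistedPiece (k := k) (e := 3) d₂ t) =
      Module.finrank k (twistedPiece (k := k) (e := 3) d₁ t) +
        Module.finrank k (twistedPiece (k := k) (e := 3) d₃ t) := by
  have := finite_twistedPiece (k := k) (e := 3) d₁ t h₁
  have := finite_twistedPiece (k := k) (e := 3) d₂ t h₂
  have := finite_twistedPiece (k := k) (e := 3) d₃ t h₃
  -- `Q` is treated as a free module of rank one with shift 0, so that `φ₁` becomes a graded map
  -- between free modules.
  let ψ : (Fin b₁ → MvPolynomial (Fin 3) k) →ₗ[MvPolynomial (Fin 3) k]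
    (Fin 1 → MvPolynomial (Fin 3) k) := LinearMap.pi fun _ => φ₁
  have hψ : IsGradedMap d₁ (fun _ : Fin 1 => 0) ψ := fun s x hx => by
    rw [mem_twistedPiece]
    exact fun i => ⟨fun _ => h.graded₁ s x hx, fun h' => by omega⟩
  have hψ0 : ∀ x, ψ x = 0 ↔ φ₁ x = 0 := fun x =>
    ⟨fun hx => congrFun hx 0, fun hx => funext fun _ => hx⟩
  have hψmap : (twistedPiece d₁ t).map (ψ.restrictScalars k) =
      twistedPiece (fun _ : Fin 1 => 0) t := by
    ext x
    simp only [Submodule.mem_map, LinearMap.coe_restrictScalars]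
    constructor
    · rintro ⟨y, hy, rfl⟩
      exact hψ t y hy
    · intro hx
      have hxI : x 0 ∈ LinearMap.range φ₁ := by
        rw [h.range_eq]
        exact ht _ (by simpa using (mem_twistedPiece.mp hx 0).1 (Nat.zero_le t))
      obtain ⟨y, hy⟩ := hxI
      have hyx : ψ y = x := by
        ext1 i
        rw [Subsingleton.elim i 0]
        exact hy
      refine ⟨twistedProj d₁ t y, twistedProj_mem d₁ t y, ?_⟩
      rw [hψ.map_twistedProj, hyx, twistedProj_of_mem t hx, if_pos rfl]
  have hker : LinearMap.ker (φ₃.restrictScalars k) = ⊥ := LinearMap.ker_eq_bot.mpr h.injective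
  have e₁ := finrank_map_add_finrank_inf_ker (ψ.restrictScalars k) (twistedPiece d₁ t)
  have e₂ := finrank_map_add_finrank_inf_ker (φ₂.restrictScalars k) (twistedPiece d₂ t)
  have e₃ := finrank_map_add_finrank_inf_ker (φ₃.restrictScalars k) (twistedPiece d₃ t)
  rw [hψmap] at e₁
  rw [IsGradedMap.map_twistedPiece_of_exact (ψ := ψ) h.graded₂
    (fun x => (hψ0 x).trans (h.exact₁ x))] at e₂
  rw [IsGradedMap.map_twistedPiece_of_exact (ψ := φ₂) h.graded₃ h.exact₂,
    hker, inf_bot_eq, finrank_bot] at e₃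
  omega

/-- For large `t`, twice the dimension of `Q(-x)` in degree `t` is `(t - x + 2)(t - x + 1)`. Three
consecutive values of `t` give three quadratics in `x` that span all polynomials of degree at most
2. -/
theorem IsMinimalGradedResolution.shiftSum_eq_zero
    (h : IsMinimalGradedResolution I d₁ d₂ d₃ φ₁ φ₂ φ₃)
    (hN : ∃ N, ∀ n ≥ N, ∀ f : MvPolynomial (Fin 3) k, f.IsHomogeneous n → f ∈ I) (A B C : ℤ) :
    shiftSum d₁ d₂ d₃ (fun x => A * x ^ 2 + B * x + C) = 0 := by
  obtain ⟨N, hN⟩ := hN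
  -- Large enough to exceed `N` and every shift, so that no degree difference is truncated.
  set T : ℕ := N + ∑ i, d₁ i + ∑ i, d₂ i + ∑ i, d₃ i with hT
  have key : ∀ t ≥ T, shiftSum d₁ d₂ d₃ (fun x => ((t : ℤ) - x + 2) * (t - x + 1)) = 0 := by
    intro t ht
    have h₁ : ∀ i, d₁ i ≤ t := fun i => by
      have := Finset.single_le_sum (fun _ _ => Nat.zero_le _) (Finset.mem_univ i) (f := d₁); omega
    have h₂ : ∀ i, d₂ i ≤ t := fun i => by
      have := Finset.single_le_sum (fun _ _ => Nat.zero_le _) (Finset.mem_univ i) (f := d₂); omega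
    have h₃ : ∀ i, d₃ i ≤ t := fun i => by
      have := Finset.single_le_sum (fun _ _ => Nat.zero_le _) (Finset.mem_univ i) (f := d₃); omega
    have e := h.finrank_eq (hN t (by omega)) h₁ h₂ h₃
    have e₀ := finrank_twistedPiece (k := k) (fun _ : Fin 1 => 0) t (fun _ => Nat.zero_le t)
    have e₁ := finrank_twistedPiece (k := k) d₁ t h₁
    have e₂ := finrank_twistedPiece (k := k) d₂ t h₂
    have e₃ := finrank_twistedPiece (k := k) d₃ t h₃
    simp only [shiftSum, LinearMap.coe_mk, AddHom.coe_mk]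
    rw [← e₁, ← e₂, ← e₃]
    simp only [Finset.univ_unique, Finset.sum_singleton, Nat.cast_zero] at e₀
    rw [← e₀]
    have e' : (_ : ℤ) = _ := congrArg (Nat.cast (R := ℤ)) e
    push_cast at e'
    linarith
  have k₀ := key T le_rfl
  have k₁ := key (T + 1) (by omega)
  have k₂ := key (T + 2) (by omega)
  push_cast at k₀ k₁ k₂
  have c₁ : shiftSum d₁ d₂ d₃ (fun _ => 1) = 0 := by
    -- The second difference in `t` is the constant 2; below, the first difference yields `x`.
    have : (2 : ℤ) • (fun _ => 1 : ℤ → ℤ) =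
        (fun x => ((T : ℤ) + 2 - x + 2) * (T + 2 - x + 1)) -
        (2 : ℤ) • (fun x => ((T : ℤ) + 1 - x + 2) * (T + 1 - x + 1)) +
        (fun x => ((T : ℤ) - x + 2) * (T - x + 1)) := by
      ext x; simp; ring
    have := congrArg (shiftSum d₁ d₂ d₃) this
    simp only [map_add, map_sub, map_smul, k₀, k₁, k₂, smul_eq_mul] at this
    omega
  have c₂ : shiftSum d₁ d₂ d₃ (fun x => x) = 0 := by
    have : (2 : ℤ) • (fun x => x : ℤ → ℤ) = (2 * (T + 2) : ℤ) • (fun _ => 1 : ℤ → ℤ) -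
        (fun x => ((T : ℤ) + 1 - x + 2) * (T + 1 - x + 1)) +
        (fun x => ((T : ℤ) - x + 2) * (T - x + 1)) := by
      ext x; simp; ring
    have := congrArg (shiftSum d₁ d₂ d₃) this
    simp only [map_add, map_sub, map_smul, k₀, k₁, c₁, smul_eq_mul] at this
    omega
  have : (fun x => A * x ^ 2 + B * x + C : ℤ → ℤ) =
      A • (fun x => ((T : ℤ) - x + 2) * (T - x + 1)) +
      (A * (2 * T + 3) + B) • (fun x => x : ℤ → ℤ) +
      (C - A * (T + 1) * (T + 2)) • (fun _ => 1 : ℤ → ℤ) := by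
    ext x; simp; ring
  rw [this]
  simp only [map_add, map_smul, k₀, c₁, c₂, smul_eq_mul]
  ring

end Resolution

/-! ### Extension of linear forms: vanishing of `Ext²` -/

section Extension

variable {R F G : Type*} [CommRing R] [AddCommGroup F] [Module R F] [AddCommGroup G] [Module R G]

/-- Linear forms on the kernel of a map onto an ideal of grade at least `3` extend to the whole
module. -/
theorem exists_extension_of_isRegularTriple {φ : F →ₗ[R] R} {ψ : G →ₗ[R] F}
    (hex : Function.Exact ψ φ) {r s t : R} (h : IsRegularTriple r s t) {u v w : F}
    (hu : φ u = r) (hv : φ v = s) (hw : φ w = t) (l : G →ₗ[R] R)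
    (hl : ∀ y, ψ y = 0 → l y = 0) : ∃ ν : F →ₗ[R] R, ∀ y, ν (ψ y) = l y := by
  have hlk : LinearMap.ker ψ ≤ LinearMap.ker l := fun y hy => hl y hy
  let l' : LinearMap.range ψ →ₗ[R] R :=
    ((LinearMap.ker ψ).liftQ l hlk).comp ψ.quotKerEquivRange.symm.toLinearMap
  have hl' : ∀ y (hy : ψ y ∈ LinearMap.range ψ), l' ⟨ψ y, hy⟩ = l y := fun y hy => by
    have : ψ.quotKerEquivRange.symm ⟨ψ y, hy⟩ = (LinearMap.ker ψ).mkQ y :=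
      ψ.quotKerEquivRange_symm_apply_image y hy
    simp only [l', LinearMap.comp_apply, LinearEquiv.coe_coe, this, Submodule.mkQ_apply,
      Submodule.liftQ_apply]
  have hmem : ∀ (p : F) (f : F), φ p • f - φ f • p ∈ LinearMap.range ψ := fun p f => by
    rw [LinearMap.mem_range]
    refine (hex _).mp ?_
    simp [mul_comm]
  -- Koszul relations: `κ p` maps `F` into `ker φ` and is multiplication by `φ p` on `ker φ`. Thus
  -- `μ u` extends `r` times the given form, and it remains to divide by `r`.
  let κ : F → F →ₗ[R] LinearMap.range ψ := fun p =>
    (φ p • LinearMap.id - φ.smulRight p).codRestrict _ (hmem p)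
  let μ : F → F →ₗ[R] R := fun p => l'.comp (κ p)
  have hκ : ∀ p f, (κ p f : F) = φ p • f - φ f • p := fun p f => rfl
  have hμψ : ∀ p y, μ p (ψ y) = φ p * l y := fun p y => by
    have : κ p (ψ y) = φ p • ⟨ψ y, LinearMap.mem_range_self ψ y⟩ := by
      ext
      rw [hκ, hex.apply_apply_eq_zero y]
      simp
    simp only [μ, LinearMap.comp_apply, this, map_smul, hl', smul_eq_mul]
  have hμμ : ∀ p q f, φ q * μ p f - φ p * μ q f = φ f * μ p q := fun p q f => by
    have : φ q • κ p f - φ p • κ q f = φ f • κ p q := by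
      ext
      push_cast
      simp only [hκ, smul_sub, smul_smul, mul_comm]
      abel
    have := congrArg l' this
    rw [map_sub, map_smul, map_smul, map_smul] at this
    exact this
  -- The cocycle identity `hμμ` puts `t * μ u v` in `(r, s)`, so regularity of `t` gives `μ u v = α
  -- r + β s`. Correcting `μ u` by `β φ`, which vanishes on `ker φ`, makes it divisible by `r`.
  have hcyc : t * μ u v = r * -(μ v w) + s * (μ u w) := by
    have := hμμ u v w
    rw [hu, hv, hw] at this
    linear_combination -this
  obtain ⟨α, β, hαβ⟩ := Ideal.mem_span_pair.mp
    (h.third _ (Ideal.mem_span_pair.mpr ⟨-(μ v w), μ u w, by rw [hcyc]; ring⟩))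
  have hdvd : ∀ f, ∃ g, r * g = μ u f - β * φ f := fun f => by
    have := hμμ u v f
    rw [hu, hv, ← hαβ] at this
    obtain ⟨g, hg⟩ := Ideal.mem_span_singleton.mp (h.second (μ u f - β * φ f)
      (Ideal.mem_span_singleton.mpr ⟨μ v f + α * φ f, by linear_combination this⟩))
    exact ⟨g, hg.symm⟩
  have hinj : ∀ x y, r * x = r * y → x = y := fun x y hxy =>
    sub_eq_zero.mp (h.first _ (by rw [mul_sub, hxy, sub_self]))
  choose g hg using hdvd
  refine ⟨{ toFun := g, map_add' := fun x y => ?_, map_smul' := fun c x => ?_ }, fun y => ?_⟩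
  · apply hinj
    rw [mul_add, hg, hg, hg, map_add, map_add]
    ring
  · apply hinj
    rw [RingHom.id_apply, smul_eq_mul, mul_left_comm, hg, hg, map_smul, map_smul, smul_eq_mul,
      smul_eq_mul]
    ring
  · apply hinj
    change r * g (ψ y) = _
    rw [hg, hμψ, hex.apply_apply_eq_zero y, hu]
    ring

end Extension

/-! ### Strict inequalities between shifts -/

theorem map_eq_zero_of_map_single_eq_zero {R α β : Type*} [CommRing R] [Fintype α] [DecidableEq α]
    {φ : (α → R) →ₗ[R] (β → R)} {i : β} (h : ∀ j, φ (Pi.single j 1) i = 0) (x : α → R) :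
    φ x i = 0 := by
  have : (LinearMap.proj i : (β → R) →ₗ[R] R).comp φ = 0 :=
    LinearMap.pi_ext' fun j => LinearMap.ext_ring (by simpa using h j)
  exact LinearMap.congr_fun this x

section Shifts

variable {k : Type*} [Field k] {e : ℕ}

/-- A matrix entry is a form of degree `d j - d' i`; nonzero without constant term, it has positive
degree. -/
theorem IsGradedMap.lt_of_entry_ne_zero {a b : ℕ} {d : Fin a → ℕ} {d' : Fin b → ℕ}
    {φ : (Fin a → MvPolynomial (Fin e) k) →ₗ[MvPolynomial (Fin e) k]
      (Fin b → MvPolynomial (Fin e) k)}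
    (h : IsGradedMap d d' φ) {j : Fin a} {i : Fin b} (hne : φ (Pi.single j 1) i ≠ 0)
    (hmin : constantCoeff (φ (Pi.single j 1) i) = 0) : d' i < d j := by
  have hmem : (Pi.single j 1 : Fin a → MvPolynomial (Fin e) k) ∈ twistedPiece d (d j) := by
    rw [mem_twistedPiece]
    intro l
    rcases eq_or_ne l j with rfl | hl
    · simpa using isHomogeneous_one (Fin e) k
    · simpa [hl] using fun _ => isHomogeneous_zero (Fin e) k _
  have hφ := mem_twistedPiece.mp (h _ _ hmem) i
  by_contra hlt
  rcases eq_or_lt_of_le (not_lt.mp hlt) with heq | hlt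
  · have h0 := hφ.1 heq.ge
    rw [heq, Nat.sub_self] at h0
    rw [← totalDegree_zero_iff_isHomogeneous, totalDegree_eq_zero_iff_eq_C] at h0
    rw [constantCoeff_eq] at hmin
    rw [hmin, map_zero] at h0
    exact hne h0
  · exact hne (hφ.2 hlt)

variable {I : Ideal (MvPolynomial (Fin e) k)} {b₁ b₂ b₃ : ℕ}
  {d₁ : Fin b₁ → ℕ} {d₂ : Fin b₂ → ℕ} {d₃ : Fin b₃ → ℕ}
  {φ₁ : (Fin b₁ → MvPolynomial (Fin e) k) →ₗ[MvPolynomial (Fin e) k] MvPolynomial (Fin e) k}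
  {φ₂ : (Fin b₂ → MvPolynomial (Fin e) k) →ₗ[MvPolynomial (Fin e) k]
    (Fin b₁ → MvPolynomial (Fin e) k)}
  {φ₃ : (Fin b₃ → MvPolynomial (Fin e) k) →ₗ[MvPolynomial (Fin e) k]
    (Fin b₂ → MvPolynomial (Fin e) k)}

namespace IsMinimalGradedResolution

theorem generator_ne_zero (h : IsMinimalGradedResolution I d₁ d₂ d₃ φ₁ φ₂ φ₃) (i : Fin b₁) :
    φ₁ (Pi.single i 1) ≠ 0 := fun h0 => by
  obtain ⟨y, hy⟩ := (h.exact₁ _).mp h0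
  have := h.minimal₂ y i
  rw [hy] at this
  simp at this

theorem syzygy_ne_zero (h : IsMinimalGradedResolution I d₁ d₂ d₃ φ₁ φ₂ φ₃) (j : Fin b₂) :
    φ₂ (Pi.single j 1) ≠ 0 := fun h0 => by
  obtain ⟨y, hy⟩ := (h.exact₂ _).mp h0
  have := h.minimal₃ y j
  rw [hy] at this
  simp at this

/-- A syzygy cannot involve `i₀` alone, because `Q` is a domain and the generators are nonzero. -/
theorem exists_generator_lt_syzygy (h : IsMinimalGradedResolution I d₁ d₂ d₃ φ₁ φ₂ φ₃)
    (j : Fin b₂) (i₀ : Fin b₁) : ∃ i ≠ i₀, d₁ i < d₂ j := by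
  by_contra! hcon
  have h0 : ∀ i ≠ i₀, φ₂ (Pi.single j 1) i = 0 := fun i hi => by
    by_contra hne
    exact absurd (IsGradedMap.lt_of_entry_ne_zero (fun t => h.graded₂ t) hne (h.minimal₂ _ i))
      (not_lt.mpr (hcon i hi))
  have h1 : φ₂ (Pi.single j 1) = φ₂ (Pi.single j 1) i₀ • Pi.single i₀ 1 := by
    ext1 i
    rcases eq_or_ne i i₀ with rfl | hi
    · simp
    · simp [h0 i hi, hi]
  have h2 := h.exact₁.apply_apply_eq_zero (Pi.single j 1)
  rw [h1, map_smul, smul_eq_mul] at h2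
  rcases mul_eq_zero.mp h2 with h3 | h3
  · exact h.syzygy_ne_zero j (by rw [h1, h3, zero_smul])
  · exact h.generator_ne_zero i₀ h3

/-- The Koszul syzygy of the generators `i` and `i'` has a nonzero entry at `i`, so row `i` of `φ₂`
is not zero. -/
theorem exists_syzygy_gt_generator (h : IsMinimalGradedResolution I d₁ d₂ d₃ φ₁ φ₂ φ₃)
    {i i' : Fin b₁} (hi : i' ≠ i) : ∃ j, d₁ i < d₂ j := by
  by_contra! hcon
  have h0 : ∀ j, φ₂ (Pi.single j 1) i = 0 := fun j => by
    by_contra hne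
    exact absurd (IsGradedMap.lt_of_entry_ne_zero (fun t => h.graded₂ t) hne (h.minimal₂ _ i))
      (not_lt.mpr (hcon j))
  have hk : φ₁ (φ₁ (Pi.single i' 1) • Pi.single i 1 - φ₁ (Pi.single i 1) • Pi.single i' 1) = 0 := by
    rw [map_sub, map_smul, map_smul, smul_eq_mul, smul_eq_mul, mul_comm, sub_self]
  obtain ⟨y, hy⟩ := (h.exact₁ _).mp hk
  have hyi := congrFun hy i
  rw [map_eq_zero_of_map_single_eq_zero h0] at hyi
  apply h.generator_ne_zero i'
  simpa [hi.symm] using hyi.symm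

theorem exists_syzygy_lt_last (h : IsMinimalGradedResolution I d₁ d₂ d₃ φ₁ φ₂ φ₃)
    (i : Fin b₃) : ∃ j, d₂ j < d₃ i := by
  by_contra! hcon
  have h0 : φ₃ (Pi.single i 1) = 0 := by
    ext1 j
    by_contra hne
    exact absurd (IsGradedMap.lt_of_entry_ne_zero (fun t => h.graded₃ t) hne (h.minimal₃ _ j))
      (not_lt.mpr (hcon j))
  have := congrFun (h.injective (h0.trans (map_zero φ₃).symm)) i
  simp at this

/-- If row `j` of `φ₃` vanished, the `j`-th coordinate form would kill `ker φ₂` and hence factor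
through `φ₂`. By minimality its value 1 on the `j`-th basis vector would then have zero constant
term. -/
theorem exists_last_gt_syzygy (h : IsMinimalGradedResolution I d₁ d₂ d₃ φ₁ φ₂ φ₃)
    (hI : 3 ≤ idealGrade I) (j : Fin b₂) : ∃ i, d₂ j < d₃ i := by
  by_contra! hcon
  have h0 : ∀ i, φ₃ (Pi.single i 1) j = 0 := fun i => by
    by_contra hne
    exact absurd (IsGradedMap.lt_of_entry_ne_zero (fun t => h.graded₃ t) hne (h.minimal₃ _ j))
      (not_lt.mpr (hcon i))
  have hl : ∀ y, φ₂ y = 0 → LinearMap.proj (R := MvPolynomial (Fin e) k)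
      (φ := fun _ => MvPolynomial (Fin e) k) j y = 0 := fun y hy => by
    obtain ⟨z, rfl⟩ := (h.exact₂ y).mp hy
    exact map_eq_zero_of_map_single_eq_zero h0 z
  obtain ⟨r, hr, s, hs, t, ht, hreg⟩ := exists_isRegularTriple hI
  rw [← h.range_eq] at hr hs ht
  obtain ⟨u, hu⟩ := hr
  obtain ⟨v, hv⟩ := hs
  obtain ⟨w, hw⟩ := ht
  obtain ⟨ν, hν⟩ := exists_extension_of_isRegularTriple h.exact₁ hreg hu hv hw _ hl
  have h1 := hν (Pi.single j 1)
  rw [LinearMap.proj_apply, Pi.single_eq_same, LinearMap.pi_apply_eq_sum_univ ν] at h1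
  have h2 := congrArg constantCoeff h1
  simp [h.minimal₂] at h2

end IsMinimalGradedResolution

end Shifts

/-! ### The numerical argument -/

/-- The numerical core: degree shifts satisfying the Herzog–Kühl equations together with the
obvious inequalities for a minimal resolution of format `(1, m, m + 1, 2)` with `m ≤ 7`. -/
theorem add_lt_of_shiftSum_eq_zero {m : ℕ} (hm7 : m ≤ 7) (d₁ : Fin m → ℕ) (d₂ : Fin (m + 1) → ℕ)
    (d₃ : Fin 2 → ℕ) (z : Fin m) {a b c : ℕ} (ha : d₁ z = a) (hab : a ≤ b)
    (hb : ∀ i ≠ z, b ≤ d₁ i) (hc : ∀ i, d₁ i < c) (hd₃ : ∀ i, b + 2 ≤ d₃ i) (hc₃ : d₃ 1 = c)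
    (hd₃c : d₃ 0 ≤ c) (hS : ∀ A B C : ℤ, shiftSum d₁ d₂ d₃ (fun x => A * x ^ 2 + B * x + C) = 0) :
    a + b < c := by
  by_contra! hcon
  have hbc : b + 2 ≤ c := hc₃ ▸ hd₃ 1
  obtain ⟨u, rfl⟩ := Nat.exists_eq_add_of_le (show b ≤ c by omega)
  have hua : u ≤ a := by omega
  have hu : 2 ≤ u := by omega
  have hua' : (u : ℤ) ≤ a := by exact_mod_cast hua
  have hu' : (2 : ℤ) ≤ u := by exact_mod_cast hu
  have hab' : (a : ℤ) ≤ b := by exact_mod_cast hab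
  have hm7' : (m : ℤ) ≤ 7 := by exact_mod_cast hm7
  let p : ℤ → ℤ := fun x => (x - b) * (x - (b + u))
  have hp : p = fun x => 1 * x ^ 2 + (-(2 * (b : ℤ) + u)) * x + b * (b + u) := by
    ext x; simp only [p]; ring
  have h0 : shiftSum d₁ d₂ d₃ p = 0 := by rw [hp]; exact hS _ _ _
  simp only [shiftSum, LinearMap.coe_mk, AddHom.coe_mk, Fin.sum_univ_two] at h0
  -- Completing the square: the minimum of `p` is `-u²/4`, at the midpoint of `[b, b + u]`.
  have hq : ∀ j, 4 * p (d₂ j) = (2 * d₂ j - (2 * b + u)) ^ 2 - (u : ℤ) ^ 2 := fun j => by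
    simp only [p]; ring
  have hS2 : 4 * ∑ j, p (d₂ j) =
      ∑ j, (2 * (d₂ j : ℤ) - (2 * b + u)) ^ 2 - (m + 1) * (u : ℤ) ^ 2 := by
    rw [Finset.mul_sum, Finset.sum_congr rfl fun j _ => hq j, Finset.sum_sub_distrib]
    simp
  have hp1 : ∀ i ∈ Finset.univ.erase z, 0 ≤ -p (d₁ i) := fun i hi => by
    have h1 : (b : ℤ) ≤ d₁ i := by exact_mod_cast hb i (Finset.ne_of_mem_erase hi)
    have h2 : (d₁ i : ℤ) < b + u := by exact_mod_cast hc i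
    simp only [p]
    nlinarith
  have hp2 : ∀ j ∈ Finset.univ, 0 ≤ (2 * (d₂ j : ℤ) - (2 * b + u)) ^ 2 := fun j _ => sq_nonneg _
  have hS1 : ∑ i, p (d₁ i) = (b - a) * (b + u - a) - ∑ i ∈ Finset.univ.erase z, -p (d₁ i) := by
    rw [← Finset.add_sum_erase _ _ (Finset.mem_univ z), Finset.sum_neg_distrib, ha]
    simp only [p]; ring
  have n1 := Finset.sum_nonneg hp1
  have n2 := Finset.sum_nonneg hp2
  have hd30 : (b : ℤ) + 2 ≤ d₃ 0 := by exact_mod_cast hd₃ 0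
  have hd30' : (d₃ 0 : ℤ) ≤ b + u := by exact_mod_cast hd₃c
  have hp3 : p (d₃ 1) = 0 := by simp [p, hc₃]
  have hp30 : p (d₃ 0) = -((d₃ 0 - b) * (b + u - d₃ 0)) := by simp only [p]; ring
  have n3 : (0 : ℤ) ≤ (d₃ 0 - b) * (b + u - d₃ 0) := mul_nonneg (by linarith) (by linarith)
  have hp00 : p 0 = b * (b + u) := by simp only [p]; ring
  rw [hp00, hS1, hp3, hp30] at h0
  have n4 : (0 : ℤ) ≤ (7 - m) * (u : ℤ) ^ 2 := mul_nonneg (by linarith) (sq_nonneg _)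
  have n5 : (0 : ℤ) ≤ a * (b - a) := mul_nonneg (by linarith) (by linarith)
  have n6 : (0 : ℤ) ≤ a * (a - u) := mul_nonneg (by linarith) (by linarith)
  have n7 : (0 : ℤ) ≤ (a - u) * u := mul_nonneg (by linarith) (by linarith)
  -- All seven summands are nonnegative, so each vanishes.
  have key : 4 * ∑ i ∈ Finset.univ.erase z, -p (d₁ i) +
      ∑ j, (2 * (d₂ j : ℤ) - (2 * b + u)) ^ 2 + 4 * ((d₃ 0 - b) * (b + u - d₃ 0)) +
      (7 - m) * (u : ℤ) ^ 2 + 8 * (a * (b - a)) + 4 * (a * (a - u)) + 8 * ((a - u) * u) = 0 := by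
    linear_combination 4 * h0 - hS2
  have z1 : ∑ i ∈ Finset.univ.erase z, -p (d₁ i) = 0 := by linarith
  have z2 : ∑ j, (2 * (d₂ j : ℤ) - (2 * b + u)) ^ 2 = 0 := by linarith
  have z3 : ((d₃ 0 : ℤ) - b) * (b + u - d₃ 0) = 0 := by linarith
  have z4 : (7 - m) * (u : ℤ) ^ 2 = 0 := by linarith
  have z5 : (a : ℤ) * (b - a) = 0 := by linarith
  have z7 : ((a : ℤ) - u) * u = 0 := by linarith
  have e4 : m = 7 := by
    rcases mul_eq_zero.mp z4 with h | h
    · omega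
    · have := pow_eq_zero_iff (two_ne_zero) |>.mp h; omega
  have e5 : b = a := by rcases mul_eq_zero.mp z5 with h | h <;> omega
  have e7 : u = a := by rcases mul_eq_zero.mp z7 with h | h <;> omega
  subst e4 e5 e7
  have e1 : ∀ i, d₁ i = u := fun i => by
    rcases eq_or_ne i z with rfl | hi
    · exact ha
    · have h := (Finset.sum_eq_zero_iff_of_nonneg hp1).mp z1 i
        (Finset.mem_erase.mpr ⟨hi, Finset.mem_univ i⟩)
      have := hc i
      rcases mul_eq_zero.mp (neg_eq_zero.mp h) with h | h <;> omega
  have e2 : ∀ j, 2 * (d₂ j : ℤ) = 3 * u := fun j => by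
    have h := (Finset.sum_eq_zero_iff_of_nonneg hp2).mp z2 j (Finset.mem_univ j)
    have := pow_eq_zero_iff (two_ne_zero) |>.mp h
    linarith
  have e3 : d₃ 0 = 2 * u := by rcases mul_eq_zero.mp z3 with h | h <;> omega
  -- In the extremal case the linear equation reads `-7u + 12u - 4u = 0`, against `u ≥ 2`.
  have hlin := hS 0 1 0
  simp only [shiftSum, LinearMap.coe_mk, AddHom.coe_mk, Fin.sum_univ_two, e1, e3, hc₃] at hlin
  have hsum : 2 * ∑ j, (d₂ j : ℤ) = 24 * u := by
    rw [Finset.mul_sum, Finset.sum_congr rfl fun j _ => e2 j]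
    simp; ring
  simp at hlin
  linarith

/-! ### Assembly -/

theorem mainTheorem8 {k : Type*} [Field k] (m : ℕ) (hm4 : 4 ≤ m) (hm7 : m ≤ 7)
    (I : Ideal (MvPolynomial (Fin 3) k))
    (hI : I.IsHomogeneous (MvPolynomial.homogeneousSubmodule (Fin 3) k))
    (hperf : IsPerfectOfGrade I 3)
    (d₁ : Fin m → ℕ) (d₂ : Fin (m + 1) → ℕ) (d₃ : Fin 2 → ℕ)
    (hd₁ : Monotone d₁) (hd₃ : Monotone d₃)
    (φ₁ : (Fin m → MvPolynomial (Fin 3) k) →ₗ[MvPolynomial (Fin 3) k] MvPolynomial (Fin 3) k)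
    (φ₂ : (Fin (m + 1) → MvPolynomial (Fin 3) k) →ₗ[MvPolynomial (Fin 3) k]
      (Fin m → MvPolynomial (Fin 3) k))
    (φ₃ : (Fin 2 → MvPolynomial (Fin 3) k) →ₗ[MvPolynomial (Fin 3) k]
      (Fin (m + 1) → MvPolynomial (Fin 3) k))
    (hres : IsMinimalGradedResolution I d₁ d₂ d₃ φ₁ φ₂ φ₃) :
    (2 ≤ initialDegree I → d₁ ⟨0, by omega⟩ + d₁ ⟨1, by omega⟩ < d₃ 1) ∧
    (m = 5 ∨ m = 6 ∨ m = 7 → ¬ d₃ 1 ≤ 2 * d₁ ⟨0, by omega⟩) := by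
  have hgrade : 3 ≤ idealGrade I := hperf.1.ge
  have h01 : d₁ ⟨0, by omega⟩ ≤ d₁ ⟨1, by omega⟩ := hd₁ (by simp [Fin.le_def])
  have hb : ∀ i : Fin m, i ≠ ⟨0, by omega⟩ → d₁ ⟨1, by omega⟩ ≤ d₁ i := fun i hi =>
    hd₁ (Fin.le_def.mpr (Nat.one_le_iff_ne_zero.mpr fun h => hi (Fin.ext h)))
  have hd₃le : ∀ i, d₃ i ≤ d₃ 1 := fun i => hd₃ (Fin.le_last i)
  have hmain : d₁ ⟨0, by omega⟩ + d₁ ⟨1, by omega⟩ < d₃ 1 := by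
    refine add_lt_of_shiftSum_eq_zero hm7 d₁ d₂ d₃ ⟨0, by omega⟩ rfl h01 hb (fun i => ?_)
      (fun i => ?_) rfl (hd₃le 0) (hres.shiftSum_eq_zero ?_)
    · have : Nontrivial (Fin m) := Fin.nontrivial_iff_two_le.mpr (by omega)
      obtain ⟨i', hi'⟩ := exists_ne i
      obtain ⟨j, hj⟩ := hres.exists_syzygy_gt_generator hi'
      obtain ⟨l, hl⟩ := hres.exists_last_gt_syzygy hgrade j
      have := hd₃le l
      omega
    -- Two strict steps up from a generator other than the first account for the `+ 2`.
    · obtain ⟨j, hj⟩ := hres.exists_syzygy_lt_last i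
      obtain ⟨l, hl, hlj⟩ := hres.exists_generator_lt_syzygy j ⟨0, by omega⟩
      have := hb l hl
      omega
    · obtain ⟨r, hr, s, hs, t, ht, hreg⟩ := exists_isRegularTriple hgrade
      have := isArtinianRing_quotient_of_isRegularTriple hr hs ht hreg
      exact exists_forall_isHomogeneous_mem hI
  exact ⟨fun _ => hmain, fun _ => by omega⟩
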